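/- Let $X$ be a real random variable that is nontrivial (not almost surely $0$), symmetric ($-X$ has the same law as $X$) and sub-gaussian (there is $b\ge 0$ with $\mathbb{E}e^{\lambda X}\le e^{\lambda^2b^2/2}$ for all $\lambda\in\mathbb{R}$). If $(X_k)_{k\ge 1}$ are iid copies of $X$ and $v\in\ell_2$, the sum $\sum_k X_k v_k$ denotes the limit of the partial sums $\sum_{k\le K}X_kv_k$ in $L_p$, for every $0<p<\infty$; this limit exists and is unique up to almost sure equality. Then there is a constant $0<C<\infty$, depending only on the law of $X$, such that for every integer $n\ge 0$, every countable set $S$ and all functions $\psi_i:S\to\mathbb{R}$, $\phi_i:S\to\ell_2$ ($1\le i\le n$) satisfying $$\psi_i(s)-\psi_i(s')\le\|\phi_i(s)-\phi_i(s')\|\qquad\text{for all } s,s'\in S,\ 1\le i\le n,$$ we have $$\mathbb{E}\sup_{s\in S}\sum_{i=1}^n\epsilon_i\psi_i(s)\le C\,\mathbb{E}\sup_{s\in S}\sum_{i=1}^n\sum_{k=1}^\infty X_{ik}\,\phi_i(s)_k ,$$ where $\epsilon_1,\dots,\epsilon_n$ are independent Rademacher variables (uniformly distributed on $\{-1,1\}$),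 the $X_{ik}$ ($1\le i\le n$, $k\ge1$) are independent copies of $X$, $\phi_i(s)_k$ is the $k$-th coordinate of $\phi_i(s)$, and suprema and expectations take values in $[-\infty,\infty]$. If $X$ is a Rademacher variable the inequality holds with $C=\sqrt2$, and if $X$ is standard normal it holds with $C=\sqrt{\pi/2}$. -/

import Mathlib

open MeasureTheory ProbabilityTheory Filter Topology
open scoped ENNReal NNReal

universe u v w

/-- The Rademacher law: the uniform distribution on `{-1, 1}`. -/
noncomputable def rademacherLaw : Measure ℝ :=
  (2⁻¹ : ℝ≥0∞) • Measure.dirac (-1) + (2⁻¹ : ℝ≥0∞) • Measure.dirac 1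

/-- The law `μ` is symmetric: if `X` has law `μ`, then so has `-X`. -/
def IsSymmetricLaw (μ : Measure ℝ) : Prop :=
  μ.map (fun x => -x) = μ

/-- The law `μ` is sub-gaussian: there is a `b` such that a variable `X` of law `μ` satisfies
`E exp (t X) ≤ exp (t ^ 2 b ^ 2 / 2)` for every real `t`, with `exp (t X)` integrable. -/
def IsSubgaussianLaw (μ : Measure ℝ) : Prop :=
  ∃ b : ℝ≥0, HasSubgaussianMGF id (b ^ 2) μ

/-- The family `X` consists of independent random variables with common law `μ`. -/
def IsIIDWithLaw {ι Ω : Type*} [MeasurableSpace Ω] (P : Measure Ω) (X : ι → Ω → ℝ)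
    (μ : Measure ℝ) : Prop :=
  iIndepFun X P ∧ ∀ j, HasLaw (X j) μ P

/-- The expectation of an extended real random variable, `E f⁺ - E f⁻` with values in `[-∞, ∞]`.
It is the usual expectation whenever `E f⁺` and `E f⁻` are not both infinite. -/
noncomputable def extExpectation {Ω : Type*} [MeasurableSpace Ω] (P : Measure Ω)
    (f : Ω → EReal) : EReal :=
  ((∫⁻ ω, (f ω).toENNReal ∂P : ℝ≥0∞) : EReal) - ((∫⁻ ω, (-f ω).toENNReal ∂P : ℝ≥0∞) : EReal)

/-- `Z` is (a version of) the sum `∑ k, X k * v k`: the partial sums converge to `Z` in `L_p`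
for all `0 < p < ∞`. -/
def IsSeriesSum {Ω : Type*} [MeasurableSpace Ω] (P : Measure Ω) (X : ℕ → Ω → ℝ)
    (v : lp (fun _ : ℕ => ℝ) 2) (Z : Ω → ℝ) : Prop :=
  AEStronglyMeasurable Z P ∧
    ∀ p : ℝ≥0∞, p ≠ 0 → p ≠ ∞ →
      Tendsto (fun K : ℕ => eLpNorm (fun ω => (∑ k ∈ Finset.range K, X k ω * v k) - Z ω) p P)
        atTop (𝓝 0)

open Classical in
/-- The random variable `∑ k, X k * v k`, for `v` in `ℓ₂`: a version of the limit in `L_p`,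
`0 < p < ∞`, of the partial sums. It is unique up to almost sure equality. The value `0` is used
if there is no limit, which does not occur for iid sub-gaussian centred `X k`. -/
noncomputable def randomSeries {Ω : Type*} [MeasurableSpace Ω] (P : Measure Ω) (X : ℕ → Ω → ℝ)
    (v : lp (fun _ : ℕ => ℝ) 2) : Ω → ℝ :=
  if h : ∃ Z : Ω → ℝ, IsSeriesSum P X v Z then h.choose else 0

/-- The vector contraction inequality with constant `C` holds for the law `μ`:
`E sup_s ∑ i, ε i * ψ i s ≤ C * E sup_s ∑ i, ∑ k, X (i, k) * φ i s k` for all countable `S`, all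
`ψ i : S → ℝ` and `φ i : S → ℓ₂` with `ψ i s - ψ i s' ≤ ‖φ i s - φ i s'‖`, all independent
Rademacher variables `ε i` and all iid variables `X (i, k)` of law `μ`. Suprema and expectations
are taken in `[-∞, ∞]`. -/
def VectorContraction (μ : Measure ℝ) (C : ℝ) : Prop :=
  ∀ (n : ℕ) (S : Type u) [Countable S]
    (ψ : Fin n → S → ℝ) (φ : Fin n → S → lp (fun _ : ℕ => ℝ) 2),
    (∀ i s s', ψ i s - ψ i s' ≤ ‖φ i s - φ i s'‖) →
    ∀ (Ω : Type v) [MeasurableSpace Ω] (P : Measure Ω) [IsProbabilityMeasure P]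
      (ε : Fin n → Ω → ℝ), IsIIDWithLaw P ε rademacherLaw →
    ∀ (Ω' : Type w) [MeasurableSpace Ω'] (P' : Measure Ω') [IsProbabilityMeasure P']
      (X : Fin n × ℕ → Ω' → ℝ), IsIIDWithLaw P' X μ →
    extExpectation P (fun ω => ⨆ s : S, ((∑ i, ε i ω * ψ i s : ℝ) : EReal)) ≤
      (C : EReal) * extExpectation P' (fun ω => ⨆ s : S,
        ((∑ i, randomSeries P' (fun k => X (i, k)) (φ i s) ω : ℝ) : EReal))

/-! The Rademacher variables can be replaced one index `i` at a time, because with all other indices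
frozen their contribution is only a translation `f s` inside the supremum. For one index, let `s₁`
and `s₂` maximise `ψ + f` and `-ψ + f`. Twice the Rademacher expectation is `ψ s₁ - ψ s₂ + f s₁ + f
s₂`, and the hypothesis bounds `ψ s₁ - ψ s₂` by `‖φ s₁ - φ s₂‖`. A Khintchine bound `‖v‖ ≤ C E|∑ X_k
v_k|` turns this norm into the mean of an absolute value, which by symmetry of the law is absorbed
by two copies of the expected supremum (`supDominated_rademacher`). Independent indices are combined
by `SupDominated.conv`.

The constant is therefore the Khintchine constant. For signs, `sqrt_sum_sq_le_cubeMean` gives `√2`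
by the argument of Latała and Oleszkiewicz: for `f = |∑ ε_k v_k|`, evenness improves the Poincaré
inequality by a factor two, while the triangle inequality bounds the energy of `f` by the mean of
`f²`. Extra random signs and Cauchy–Schwarz extend this to symmetric laws with constant `√2 / E|X|`
(`hasKhintchineConst_of_symmetric`); for the normal law the exact value of `E|X|` suffices.

Sub-gaussianity makes the series converge in every `L_p` (`exists_isSeriesSum`), and countable `S`
is exhausted by finite sets (`extExpectation_iSup_le`). -/

/-! ### Poincaré and Khintchine inequalities on the discrete cube. -/

section DiscreteCube

/-- The mean of a function on the discrete cube. -/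
noncomputable def cubeMean {n : ℕ} (f : (Fin n → Bool) → ℝ) : ℝ :=
  (∑ e, f e) / 2 ^ n

/-- The sign attached to a Boolean. -/
def boolSign (b : Bool) : ℝ := if b then 1 else -1

@[simp] lemma boolSign_true : boolSign true = 1 := rfl

@[simp] lemma boolSign_false : boolSign false = -1 := rfl

@[simp] lemma boolSign_not (b : Bool) : boolSign (!b) = -boolSign b := by
  cases b <;> simp

/-- Flip one coordinate of a point of the cube. -/
def cubeFlip {n : ℕ} (i : Fin n) (e : Fin n → Bool) : Fin n → Bool :=
  Function.update e i (!e i)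

lemma cubeFlip_involutive {n : ℕ} (i : Fin n) : Function.Involutive (cubeFlip i) := by
  intro e
  ext k
  by_cases h : k = i
  · subst h
    simp [cubeFlip]
  · simp [cubeFlip, h]

/-- The Dirichlet energy of a function on the cube. -/
noncomputable def cubeEnergy {n : ℕ} (f : (Fin n → Bool) → ℝ) : ℝ :=
  cubeMean fun e => ∑ i, (f e - f (cubeFlip i e)) ^ 2 / 4

lemma cubeMean_succ {n : ℕ} (f : (Fin (n + 1) → Bool) → ℝ) :
    cubeMean f = cubeMean fun e => (f (Fin.cons true e) + f (Fin.cons false e)) / 2 := by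
  unfold cubeMean
  rw [← (Fin.consEquiv fun _ => Bool).sum_comp, Fintype.sum_prod_type, Fintype.sum_bool,
    ← Finset.sum_add_distrib, ← Finset.sum_div, pow_succ]
  rw [div_div, mul_comm]
  rfl

lemma cubeMean_add {n : ℕ} (f g : (Fin n → Bool) → ℝ) :
    cubeMean (fun e => f e + g e) = cubeMean f + cubeMean g := by
  simp [cubeMean, Finset.sum_add_distrib, add_div]

lemma cubeMean_const_mul {n : ℕ} (c : ℝ) (f : (Fin n → Bool) → ℝ) :
    cubeMean (fun e => c * f e) = c * cubeMean f := by
  simp [cubeMean, ← Finset.mul_sum, mul_div_assoc]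

lemma cubeMean_mono {n : ℕ} {f g : (Fin n → Bool) → ℝ} (h : ∀ e, f e ≤ g e) :
    cubeMean f ≤ cubeMean g := by
  unfold cubeMean
  gcongr with e
  exact h e

lemma cubeMean_comp {n : ℕ} (f : (Fin n → Bool) → ℝ) (σ : Equiv.Perm (Fin n → Bool)) :
    cubeMean (fun e => f (σ e)) = cubeMean f := by
  rw [cubeMean, cubeMean, Equiv.sum_comp σ f]

lemma cubeMean_sum {n : ℕ} {ι : Type*} (s : Finset ι) (f : ι → (Fin n → Bool) → ℝ) :
    cubeMean (fun e => ∑ i ∈ s, f i e) = ∑ i ∈ s, cubeMean (f i) := by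
  unfold cubeMean
  rw [Finset.sum_comm, Finset.sum_div]

lemma cubeMean_const {n : ℕ} (c : ℝ) : cubeMean (fun _ : Fin n → Bool => c) = c := by
  simp [cubeMean]

lemma cubeEnergy_nonneg {n : ℕ} (f : (Fin n → Bool) → ℝ) : 0 ≤ cubeEnergy f := by
  unfold cubeEnergy cubeMean
  positivity

/-- The part of `f` that is even in the first coordinate. -/
noncomputable def cubeEven {n : ℕ} (f : (Fin (n + 1) → Bool) → ℝ) (e : Fin n → Bool) : ℝ :=
  (f (Fin.cons true e) + f (Fin.cons false e)) / 2

/-- The part of `f` that is odd in the first coordinate. -/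
noncomputable def cubeOdd {n : ℕ} (f : (Fin (n + 1) → Bool) → ℝ) (e : Fin n → Bool) : ℝ :=
  (f (Fin.cons true e) - f (Fin.cons false e)) / 2

lemma cubeFlip_zero_cons {n : ℕ} (b : Bool) (e : Fin n → Bool) :
    cubeFlip 0 (Fin.cons b e : Fin (n + 1) → Bool) = Fin.cons (!b) e := by
  simp [cubeFlip]

lemma cubeFlip_succ_cons {n : ℕ} (i : Fin n) (b : Bool) (e : Fin n → Bool) :
    cubeFlip i.succ (Fin.cons b e : Fin (n + 1) → Bool) = Fin.cons b (cubeFlip i e) := by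
  simp [cubeFlip, Fin.cons_update]

lemma cubeMean_eq_even {n : ℕ} (f : (Fin (n + 1) → Bool) → ℝ) :
    cubeMean f = cubeMean (cubeEven f) :=
  cubeMean_succ f

lemma cubeMean_sq_succ {n : ℕ} (f : (Fin (n + 1) → Bool) → ℝ) :
    cubeMean (fun e => f e ^ 2) =
      cubeMean (fun e => cubeEven f e ^ 2) + cubeMean (fun e => cubeOdd f e ^ 2) := by
  rw [cubeMean_succ, ← cubeMean_add]
  congr 1
  ext e
  simp only [cubeEven, cubeOdd]
  ring

/-- Flipping coordinate `0` fixes the even part and negates the odd part, which produces the last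
term. The other flips act on both parts separately, and the cross terms cancel on averaging over
coordinate `0`. -/
lemma cubeEnergy_succ {n : ℕ} (f : (Fin (n + 1) → Bool) → ℝ) :
    cubeEnergy f =
      cubeEnergy (cubeEven f) + cubeEnergy (cubeOdd f) + cubeMean (fun e => cubeOdd f e ^ 2) := by
  unfold cubeEnergy
  rw [cubeMean_succ, ← cubeMean_add, ← cubeMean_add]
  congr 1
  ext e
  simp only [Fin.sum_univ_succ, cubeFlip_zero_cons, cubeFlip_succ_cons]
  rw [← Finset.sum_add_distrib, add_add_add_comm, ← Finset.sum_add_distrib, add_div,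
    Finset.sum_div, add_comm]
  congr 1
  · refine Finset.sum_congr rfl fun i _ => ?_
    simp only [cubeEven, cubeOdd]
    ring
  · simp only [cubeOdd, Bool.not_true, Bool.not_false]
    ring

/-- The Poincaré inequality on the discrete cube. -/
lemma cube_poincare {n : ℕ} (f : (Fin n → Bool) → ℝ) :
    cubeMean (fun e => f e ^ 2) - cubeMean f ^ 2 ≤ cubeEnergy f := by
  induction n with
  | zero => simp [cubeMean, cubeEnergy]
  | succ n ih =>
    rw [cubeMean_sq_succ, cubeMean_eq_even, cubeEnergy_succ]
    linarith [ih (cubeEven f), cubeEnergy_nonneg (cubeOdd f)]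

/-- The Poincaré inequality on the discrete cube improves by a factor of two up to the
contribution of the linear Walsh coefficients. -/
lemma cube_poincare_two {n : ℕ} (f : (Fin n → Bool) → ℝ) :
    2 * (cubeMean (fun e => f e ^ 2) - cubeMean f ^ 2) ≤
      cubeEnergy f + ∑ i, cubeMean (fun e => boolSign (e i) * f e) ^ 2 := by
  induction n with
  | zero => simp [cubeMean, cubeEnergy]
  | succ n ih =>
    have h0 : cubeMean (fun e => boolSign (e 0) * f e) = cubeMean (cubeOdd f) := by
      rw [cubeMean_succ]
      congr 1
      ext e
      simp only [cubeOdd, Fin.cons_zero, boolSign_true, boolSign_false]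
      ring
    have hs (i : Fin n) : cubeMean (fun e => boolSign (e i.succ) * f e) =
        cubeMean (fun e => boolSign (e i) * cubeEven f e) := by
      rw [cubeMean_succ]
      congr 1
      ext e
      simp only [cubeEven, Fin.cons_succ]
      ring
    rw [cubeMean_sq_succ, cubeMean_eq_even, cubeEnergy_succ, Fin.sum_univ_succ, h0]
    simp only [hs]
    -- The odd part needs only the ordinary Poincaré inequality: its second moment already occurs
    -- once in the energy, and its squared mean is the new linear coefficient.
    linarith [ih (cubeEven f), cube_poincare (cubeOdd f)]

/-- Discrete integration by parts: each flip preserves the uniform measure, so `f²` and its flipped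
version have the same mean. -/
lemma cubeEnergy_eq {n : ℕ} (f : (Fin n → Bool) → ℝ) :
    cubeEnergy f = cubeMean fun e => f e * (∑ i, (f e - f (cubeFlip i e))) / 2 := by
  have h (i : Fin n) : cubeMean (fun e => (f e - f (cubeFlip i e)) ^ 2 / 4) =
      cubeMean fun e => f e * (f e - f (cubeFlip i e)) / 2 := by
    have h1 := cubeMean_comp (fun e => f e ^ 2) (cubeFlip_involutive i).toPerm
    simp only [Function.Involutive.coe_toPerm] at h1
    have h2 : (fun e => (f e - f (cubeFlip i e)) ^ 2 / 4) = fun e =>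
        f e * (f e - f (cubeFlip i e)) / 2 +
          ((1 / 4) * f (cubeFlip i e) ^ 2 + (-1 / 4) * f e ^ 2) := by
      ext e
      ring
    rw [h2, cubeMean_add, cubeMean_add, cubeMean_const_mul, cubeMean_const_mul, h1]
    ring
  unfold cubeEnergy
  rw [cubeMean_sum]
  simp only [h, Finset.mul_sum, Finset.sum_div]
  rw [cubeMean_sum]

lemma cubeMean_signSum_sq {n : ℕ} (v : Fin n → ℝ) :
    cubeMean (fun e => (∑ i, boolSign (e i) * v i) ^ 2) = ∑ i, v i ^ 2 := by
  induction n with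
  | zero => simp [cubeMean]
  | succ n ih =>
    rw [cubeMean_succ, Fin.sum_univ_succ, ← ih, ← cubeMean_const (n := n) (v 0 ^ 2),
      ← cubeMean_add]
    congr 1
    ext e
    simp only [Fin.sum_univ_succ, Fin.cons_zero, Fin.cons_succ, boolSign_true, boolSign_false]
    ring

/-- The flipped sums `a - 2 ε_i v_i` add up to `(n - 2) a`, so the triangle inequality bounds the
sum of their absolute values below by `(n - 2)|a|`. -/
lemma sum_abs_signSum_flip {n : ℕ} (v : Fin n → ℝ) (e : Fin n → Bool) :
    ∑ i, (|∑ k, boolSign (e k) * v k| - |∑ k, boolSign (cubeFlip i e k) * v k|) ≤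
      2 * |∑ k, boolSign (e k) * v k| := by
  set a := ∑ k, boolSign (e k) * v k with ha
  have h1 (i : Fin n) : ∑ k, boolSign (cubeFlip i e k) * v k = a - 2 * (boolSign (e i) * v i) := by
    rw [ha, eq_sub_iff_add_eq, ← Finset.sum_erase_add _ _ (Finset.mem_univ i),
      ← Finset.sum_erase_add _ (fun k => boolSign (e k) * v k) (Finset.mem_univ i)]
    have : ∑ k ∈ Finset.univ.erase i, boolSign (cubeFlip i e k) * v k =
        ∑ k ∈ Finset.univ.erase i, boolSign (e k) * v k := by
      refine Finset.sum_congr rfl fun k hk => ?_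
      rw [cubeFlip, Function.update_of_ne (Finset.ne_of_mem_erase hk)]
    rw [this]
    simp [cubeFlip]
    ring
  have h2 : |((n : ℝ) - 2) * a| ≤ ∑ i, |∑ k, boolSign (cubeFlip i e k) * v k| := by
    have : ((n : ℝ) - 2) * a = ∑ i, ∑ k, boolSign (cubeFlip i e k) * v k := by
      simp only [h1, Finset.sum_sub_distrib, ← Finset.mul_sum, ← ha]
      simp
      ring
    rw [this]
    exact Finset.abs_sum_le_sum_abs _ _
  rw [Finset.sum_sub_distrib]
  rw [abs_mul] at h2
  have h3 : ((n : ℝ) - 2) * |a| ≤ |(n : ℝ) - 2| * |a| := by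
    gcongr
    exact le_abs_self _
  simp
  linarith

/-- The Khintchine inequality with Szarek's optimal constant, on the discrete cube. -/
lemma sqrt_sum_sq_le_cubeMean {n : ℕ} (v : Fin n → ℝ) :
    √(∑ i, v i ^ 2) ≤ √2 * cubeMean fun e => |∑ i, boolSign (e i) * v i| := by
  set f : (Fin n → Bool) → ℝ := fun e => |∑ i, boolSign (e i) * v i| with hf
  -- `f` is invariant under the global sign change, so its linear Walsh coefficients vanish.
  have hodd (i : Fin n) : cubeMean (fun e => boolSign (e i) * f e) = 0 := by
    have hinv : Function.Involutive fun (e : Fin n → Bool) (k : Fin n) => !e k := by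
      intro e
      simp
    have h1 := cubeMean_comp (fun e => boolSign (e i) * f e) (hinv.toPerm _)
    have h2 : (fun e => boolSign ((hinv.toPerm _) e i) * f ((hinv.toPerm _) e)) =
        fun e => -1 * (boolSign (e i) * f e) := by
      ext e
      simp [hf, Finset.sum_neg_distrib]
    rw [h2, cubeMean_const_mul] at h1
    linarith
  have hE : cubeEnergy f ≤ cubeMean fun e => f e ^ 2 := by
    rw [cubeEnergy_eq]
    refine cubeMean_mono fun e => ?_
    have := mul_le_mul_of_nonneg_left (sum_abs_signSum_flip v e)
      (abs_nonneg (∑ i, boolSign (e i) * v i))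
    simp only [hf]
    nlinarith
  have hP := cube_poincare_two f
  simp only [hodd] at hP
  have hsq : cubeMean (fun e => f e ^ 2) = ∑ i, v i ^ 2 := by
    rw [← cubeMean_signSum_sq]
    simp [hf]
  have h0 : 0 ≤ cubeMean f := by
    unfold cubeMean
    positivity
  rw [← hsq]
  refine Real.sqrt_le_iff.2 ⟨by positivity, ?_⟩
  rw [mul_pow, Real.sq_sqrt zero_le_two]
  simp at hP
  linarith

end DiscreteCube

/-! ### Moments of sub-gaussian sums and convergence of the random series. -/

section Subgaussian

/-- A bound for the `L_n` norm of a sub-gaussian variable with variance proxy `1`. -/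
noncomputable def subgaussianMoment (n : ℕ) : ℝ≥0∞ :=
  ENNReal.ofReal (n.factorial * (2 * Real.exp (1 / 2))) ^ (1 / (n : ℝ))

lemma subgaussianMoment_ne_top (n : ℕ) : subgaussianMoment n ≠ ∞ :=
  ENNReal.rpow_ne_top_of_nonneg (by positivity) ENNReal.ofReal_ne_top

lemma abs_pow_le_factorial_mul_exp (x : ℝ) (n : ℕ) :
    |x| ^ n ≤ n.factorial * (Real.exp x + Real.exp (-x)) := by
  have h1 := Real.pow_div_factorial_le_exp |x| (abs_nonneg x) n
  rw [div_le_iff₀ (by positivity), mul_comm] at h1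
  refine h1.trans ?_
  gcongr
  rcases abs_cases x with h | h <;> rw [h.1] <;> linarith [Real.exp_pos x, Real.exp_pos (-x)]

lemma eLpNorm_le_subgaussianMoment {Ω : Type*} [MeasurableSpace Ω] {P : Measure Ω} {W : Ω → ℝ}
    {c : ℝ≥0} (hW : HasSubgaussianMGF W c P) (hc : c ≤ 1) {n : ℕ} (hn : n ≠ 0) :
    eLpNorm W n P ≤ subgaussianMoment n := by
  have hmgf (s : ℝ) (hs : s ^ 2 = 1) : ∫ ω, Real.exp (s * W ω) ∂P ≤ Real.exp (1 / 2) := by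
    refine (hW.mgf_le s).trans (Real.exp_le_exp.2 ?_)
    have : (c : ℝ) ≤ 1 := by exact_mod_cast hc
    rw [hs]
    linarith
  have h1 := hmgf 1 (by norm_num)
  have h2 := hmgf (-1) (by norm_num)
  have i1 := hW.integrable_exp_mul 1
  have i2 := hW.integrable_exp_mul (-1)
  simp only [one_mul, neg_mul] at h1 h2 i1 i2
  have hint : Integrable (fun ω => n.factorial * (Real.exp (W ω) + Real.exp (-W ω))) P :=
    (i1.add i2).const_mul _
  rw [eLpNorm_eq_lintegral_rpow_enorm_toReal (by simpa using hn) (by simp)]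
  simp only [ENNReal.toReal_natCast, ENNReal.rpow_natCast]
  unfold subgaussianMoment
  gcongr
  calc ∫⁻ ω, ‖W ω‖ₑ ^ n ∂P
      ≤ ∫⁻ ω, ENNReal.ofReal (n.factorial * (Real.exp (W ω) + Real.exp (-W ω))) ∂P := by
        refine lintegral_mono fun ω => ?_
        rw [Real.enorm_eq_ofReal_abs, ← ENNReal.ofReal_pow (abs_nonneg _)]
        exact ENNReal.ofReal_le_ofReal (abs_pow_le_factorial_mul_exp _ _)
    _ = ENNReal.ofReal (∫ ω, n.factorial * (Real.exp (W ω) + Real.exp (-W ω)) ∂P) := by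
        rw [ofReal_integral_eq_lintegral_ofReal hint (ae_of_all _ fun ω => by positivity)]
    _ ≤ _ := by
        rw [integral_const_mul, integral_add i1 i2]
        gcongr
        linarith

lemma eLpNorm_le_mul_subgaussianMoment {Ω : Type*} [MeasurableSpace Ω] {P : Measure Ω}
    {W : Ω → ℝ} {c t : ℝ≥0} (hW : HasSubgaussianMGF W c P) (ht : t ≠ 0) (hc : c ≤ t ^ 2) {n : ℕ}
    (hn : n ≠ 0) :
    eLpNorm W n P ≤ t * subgaussianMoment n := by
  have h1 := hW.const_mul ((t : ℝ)⁻¹)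
  have h2 := eLpNorm_le_subgaussianMoment h1 (by
    rw [← NNReal.coe_le_coe]
    have : (c : ℝ) ≤ t ^ 2 := by exact_mod_cast hc
    have ht' : (0 : ℝ) < t := by positivity
    push_cast
    change ((t : ℝ)⁻¹) ^ 2 * c ≤ 1
    rw [inv_pow, inv_mul_le_iff₀ (by positivity)]
    simpa using this) hn
  have h3 : W = (t : ℝ) • fun ω => (t : ℝ)⁻¹ * W ω := by
    ext ω
    have : (t : ℝ) ≠ 0 := by exact_mod_cast ht
    simp [this]
  rw [h3, eLpNorm_const_smul]
  gcongr
  simp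

lemma IsIIDWithLaw.hasSubgaussianMGF {ι Ω : Type*} [MeasurableSpace Ω] {P : Measure Ω}
    {X : ι → Ω → ℝ} {μ : Measure ℝ} (hX : IsIIDWithLaw P X μ) {c : ℝ≥0}
    (hμ : HasSubgaussianMGF id c μ) (k : ι) : HasSubgaussianMGF (X k) c P := by
  rw [← (hX.2 k).map_eq] at hμ
  exact (HasSubgaussianMGF.id_map_iff (hX.2 k).aemeasurable).1 hμ

lemma sum_mul_hasSubgaussianMGF {ι Ω : Type*} [MeasurableSpace Ω] {P : Measure Ω}
    {X : ι → Ω → ℝ} {μ : Measure ℝ} (hX : IsIIDWithLaw P X μ) {c : ℝ≥0}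
    (hμ : HasSubgaussianMGF id c μ) (v : ι → ℝ) (s : Finset ι) :
    HasSubgaussianMGF (fun ω => ∑ k ∈ s, X k ω * v k) (∑ k ∈ s, ‖v k‖₊ ^ 2 * c) P := by
  have hind : iIndepFun (fun k ω => X k ω * v k) P :=
    hX.1.comp (fun k x => x * v k) fun k => by fun_prop
  refine HasSubgaussianMGF.sum_of_iIndepFun hind fun k _ => ?_
  have h := (hX.hasSubgaussianMGF hμ k).const_mul (v k)
  have e1 : (fun ω => X k ω * v k) = fun ω => v k * X k ω := by
    ext ω
    ring
  rw [e1]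
  refine ⟨h.integrable_exp_mul, fun t => (h.mgf_le t).trans_eq ?_⟩
  change Real.exp (v k ^ 2 * c * t ^ 2 / 2) = Real.exp (|v k| ^ 2 * c * t ^ 2 / 2)
  rw [sq_abs]

/-- The partial sums of a random series. -/
def partialSum {Ω : Type*} (X : ℕ → Ω → ℝ) (v : ℕ → ℝ) (K : ℕ) (ω : Ω) : ℝ :=
  ∑ k ∈ Finset.range K, X k ω * v k

lemma IsIIDWithLaw.aestronglyMeasurable_partialSum {Ω : Type*} [MeasurableSpace Ω] {P : Measure Ω}
    {X : ℕ → Ω → ℝ} {μ : Measure ℝ} (hX : IsIIDWithLaw P X μ) (v : ℕ → ℝ) (K : ℕ) :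
    AEStronglyMeasurable (partialSum X v K) P := by
  have h (k : ℕ) : AEMeasurable (X k) P := (hX.2 k).aemeasurable
  refine AEMeasurable.aestronglyMeasurable ?_
  unfold partialSum
  fun_prop

/-- A block of the series is sub-gaussian with variance proxy `b²` times the sum of `v_k²` over the
block. This is a Cauchy difference of a convergent series, and the `L_n` norm scales like the square
root of the proxy. -/
lemma partialSum_eLpNorm_cauchy {Ω : Type*} [MeasurableSpace Ω] {P : Measure Ω}
    {X : ℕ → Ω → ℝ} {μ : Measure ℝ} (hX : IsIIDWithLaw P X μ) (hμ : IsSubgaussianLaw μ)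
    (v : lp (fun _ : ℕ => ℝ) 2) {n : ℕ} (hn : n ≠ 0) {δ : ℝ≥0∞} (hδ : δ ≠ 0) :
    ∃ N, ∀ K ≥ N, ∀ M ≥ N, eLpNorm (partialSum X v K - partialSum X v M) n P ≤ δ := by
  obtain ⟨b, hb⟩ := hμ
  obtain ⟨t, ht, htδ⟩ : ∃ t : ℝ≥0, t ≠ 0 ∧ t * subgaussianMoment n ≤ δ := by
    obtain ⟨t, h0, h1⟩ := ENNReal.exists_nnreal_pos_mul_lt (subgaussianMoment_ne_top n) hδ
    exact ⟨t, h0.ne', h1.le⟩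
  have hs : Summable fun k => ‖v k‖₊ ^ 2 * b ^ 2 := by
    refine Summable.mul_right _ ?_
    have := lp.memℓp v
    rw [memℓp_gen_iff (by norm_num)] at this
    rw [← NNReal.summable_coe]
    simpa using this
  have hcau := hs.hasSum.tendsto_sum_nat.cauchySeq
  rw [Metric.cauchySeq_iff] at hcau
  obtain ⟨N, hN⟩ := hcau (t ^ 2) (by positivity)
  have key : ∀ M ≥ N, ∀ K ≥ M, eLpNorm (partialSum X v K - partialSum X v M) n P ≤ δ := by
    intro M hM K hK
    have e1 : partialSum X v K - partialSum X v M =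
        fun ω => ∑ k ∈ Finset.Ico M K, X k ω * v k := by
      ext ω
      simp only [Pi.sub_apply, partialSum]
      exact (Finset.sum_Ico_eq_sub _ hK).symm
    rw [e1]
    refine (eLpNorm_le_mul_subgaussianMoment
      (sum_mul_hasSubgaussianMGF hX hb v (Finset.Ico M K)) ht ?_ hn).trans htδ
    have h1 := hN K (hM.le.trans hK) M hM
    rw [NNReal.dist_eq] at h1
    have h2 : ((∑ k ∈ Finset.Ico M K, ‖v k‖₊ ^ 2 * b ^ 2 : ℝ≥0) : ℝ) =
        ((∑ k ∈ Finset.range K, ‖v k‖₊ ^ 2 * b ^ 2 : ℝ≥0) : ℝ) -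
          ((∑ k ∈ Finset.range M, ‖v k‖₊ ^ 2 * b ^ 2 : ℝ≥0) : ℝ) := by
      push_cast
      exact Finset.sum_Ico_eq_sub _ hK
    rw [← NNReal.coe_le_coe, h2]
    push_cast at h1 ⊢
    exact (le_abs_self _).trans h1.le
  refine ⟨N, fun K hK M hM => ?_⟩
  rcases le_total M K with h | h
  · exact key M hM K h
  · rw [eLpNorm_sub_comm]
    exact key K hK M h

lemma IsIIDWithLaw.memLp_partialSum {Ω : Type*} [MeasurableSpace Ω] {P : Measure Ω}
    {X : ℕ → Ω → ℝ} {μ : Measure ℝ} (hX : IsIIDWithLaw P X μ) (hμ : IsSubgaussianLaw μ)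
    (v : ℕ → ℝ) (K : ℕ) : MemLp (partialSum X v K) 1 P := by
  obtain ⟨b, hb⟩ := hμ
  exact (sum_mul_hasSubgaussianMGF hX hb v (Finset.range K)).memLp 1

/-- The limit is taken once, in the complete space `L_1`. Fatou's lemma along an almost surely
convergent subsequence shows that the same limit serves for every exponent. -/
lemma exists_isSeriesSum {Ω : Type*} [MeasurableSpace Ω] {P : Measure Ω} [IsProbabilityMeasure P]
    {X : ℕ → Ω → ℝ} {μ : Measure ℝ} (hX : IsIIDWithLaw P X μ) (hμ : IsSubgaussianLaw μ)
    (v : lp (fun _ : ℕ => ℝ) 2) : ∃ Z, IsSeriesSum P X v Z := by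
  have hmem := hX.memLp_partialSum hμ v
  have hcau : CauchySeq fun K => (hmem K).toLp := by
    rw [Lp.cauchySeq_Lp_iff_cauchySeq_eLpNorm, ENNReal.tendsto_nhds_zero]
    intro δ hδ
    obtain ⟨N, hN⟩ := partialSum_eLpNorm_cauchy hX hμ v one_ne_zero hδ.ne'
    filter_upwards [eventually_ge_atTop (N, N)] with q hq
    refine le_trans (le_of_eq ?_) (hN q.1 hq.1 q.2 hq.2)
    rw [Nat.cast_one]
    exact eLpNorm_congr_ae ((hmem q.1).coeFn_toLp.sub (hmem q.2).coeFn_toLp)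
  obtain ⟨Z, hZ⟩ := cauchySeq_tendsto_of_complete hcau
  have hZ1 : Tendsto (fun K => eLpNorm (partialSum X v K - (Z : Ω → ℝ)) 1 P) atTop (𝓝 0) := by
    rw [Lp.tendsto_Lp_iff_tendsto_eLpNorm'] at hZ
    refine hZ.congr fun K => eLpNorm_congr_ae ?_
    exact (hmem K).coeFn_toLp.sub (ae_eq_refl _)
  have hZm : AEStronglyMeasurable Z P := Lp.aestronglyMeasurable Z
  obtain ⟨ns, hns, hlim⟩ := (tendstoInMeasure_of_tendsto_eLpNorm one_ne_zero
    (fun K => (hmem K).1) hZm hZ1).exists_seq_tendsto_ae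
  refine ⟨Z, hZm, fun p hp0 hptop => ?_⟩
  rw [ENNReal.tendsto_nhds_zero]
  intro δ hδ
  -- On a probability space an integer exponent above `p` suffices, which also covers `p < 1`.
  have hpn : p ≤ (⌈p.toReal⌉₊ : ℕ) := by
    rw [← ENNReal.ofReal_toReal hptop, ← ENNReal.ofReal_natCast]
    exact ENNReal.ofReal_le_ofReal (by simpa [ENNReal.toReal_ofReal] using Nat.le_ceil p.toReal)
  have hn : ⌈p.toReal⌉₊ ≠ 0 := by
    have := ENNReal.toReal_pos hp0 hptop
    simpa using this
  obtain ⟨N, hN⟩ := partialSum_eLpNorm_cauchy hX hμ v hn hδ.ne'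
  filter_upwards [eventually_ge_atTop N] with K hK
  have hmeas := hX.aestronglyMeasurable_partialSum v
  refine (eLpNorm_le_eLpNorm_of_exponent_le hpn ((hmeas K).sub hZm)).trans ?_
  refine (Lp.eLpNorm_lim_le_liminf_eLpNorm (f := fun j => partialSum X v K - partialSum X v (ns j))
    (fun j => (hmeas K).sub (hmeas (ns j))) _ ?_).trans ?_
  · filter_upwards [hlim] with ω hω
    exact hω.const_sub _
  · refine liminf_le_of_le (by isBoundedDefault) fun a ha => ?_
    obtain ⟨j, h1, h2⟩ := (ha.and (hns.tendsto_atTop.eventually_ge_atTop N)).exists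
    exact h1.trans (hN K hK _ h2)

lemma isSeriesSum_randomSeries {Ω : Type*} [MeasurableSpace Ω] {P : Measure Ω}
    [IsProbabilityMeasure P] {X : ℕ → Ω → ℝ} {μ : Measure ℝ} (hX : IsIIDWithLaw P X μ)
    (hμ : IsSubgaussianLaw μ) (v : lp (fun _ : ℕ => ℝ) 2) :
    IsSeriesSum P X v (randomSeries P X v) := by
  have h := exists_isSeriesSum hX hμ v
  rw [randomSeries, dif_pos h]
  exact h.choose_spec

lemma IsSeriesSum.tendsto_one {Ω : Type*} [MeasurableSpace Ω] {P : Measure Ω}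
    {X : ℕ → Ω → ℝ} {v : lp (fun _ : ℕ => ℝ) 2} {Z : Ω → ℝ} (hZ : IsSeriesSum P X v Z) :
    Tendsto (fun K => eLpNorm (partialSum X v K - Z) 1 P) atTop (𝓝 0) :=
  hZ.2 1 one_ne_zero ENNReal.one_ne_top

lemma IsSeriesSum.integrable {Ω : Type*} [MeasurableSpace Ω] {P : Measure Ω}
    {X : ℕ → Ω → ℝ} {μ : Measure ℝ} (hX : IsIIDWithLaw P X μ) (hμ : IsSubgaussianLaw μ)
    {v : lp (fun _ : ℕ => ℝ) 2} {Z : Ω → ℝ} (hZ : IsSeriesSum P X v Z) : Integrable Z P :=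
  memLp_one_iff_integrable.1 (Lp.memLp_of_cauchy_tendsto le_rfl (hX.memLp_partialSum hμ v) Z hZ.1
    hZ.tendsto_one)

lemma IsSeriesSum.congr {Ω : Type*} [MeasurableSpace Ω] {P : Measure Ω}
    {X : ℕ → Ω → ℝ} {v : lp (fun _ : ℕ => ℝ) 2} {Z Z' : Ω → ℝ} (hZ : IsSeriesSum P X v Z)
    (h : Z =ᵐ[P] Z') : IsSeriesSum P X v Z' := by
  refine ⟨hZ.1.congr h, fun p h0 h1 => (hZ.2 p h0 h1).congr fun K => eLpNorm_congr_ae ?_⟩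
  filter_upwards [h] with ω hω
  rw [hω]

lemma IsSeriesSum.ae_eq {Ω : Type*} [MeasurableSpace Ω] {P : Measure Ω}
    {X : ℕ → Ω → ℝ} {μ : Measure ℝ} (hX : IsIIDWithLaw P X μ) {v : lp (fun _ : ℕ => ℝ) 2}
    {Z Z' : Ω → ℝ} (hZ : IsSeriesSum P X v Z) (hZ' : IsSeriesSum P X v Z') : Z =ᵐ[P] Z' :=
  tendstoInMeasure_ae_unique
    (tendstoInMeasure_of_tendsto_eLpNorm one_ne_zero (hX.aestronglyMeasurable_partialSum v) hZ.1
      hZ.tendsto_one)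
    (tendstoInMeasure_of_tendsto_eLpNorm one_ne_zero (hX.aestronglyMeasurable_partialSum v) hZ'.1
      hZ'.tendsto_one)

lemma IsSeriesSum.neg {Ω : Type*} [MeasurableSpace Ω] {P : Measure Ω}
    {X : ℕ → Ω → ℝ} {v : lp (fun _ : ℕ => ℝ) 2} {Z : Ω → ℝ} (hZ : IsSeriesSum P X v Z) :
    IsSeriesSum P (fun k ω => -X k ω) v (fun ω => -Z ω) := by
  refine ⟨hZ.1.neg, fun p h0 h1 => (hZ.2 p h0 h1).congr fun K => ?_⟩
  rw [← eLpNorm_neg]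
  congr 1
  ext ω
  simp [Finset.sum_neg_distrib]
  ring

lemma IsSeriesSum.comp {Ω Ω' : Type*} [MeasurableSpace Ω] [MeasurableSpace Ω'] {P : Measure Ω}
    {P' : Measure Ω'} {X : ℕ → Ω → ℝ} {v : lp (fun _ : ℕ => ℝ) 2} {Z : Ω → ℝ} {T : Ω' → Ω}
    (hX : ∀ k, Measurable (X k)) (hT : HasLaw T P P') (hZ : IsSeriesSum P X v Z) :
    IsSeriesSum P' (fun k ω => X k (T ω)) v (fun ω => Z (T ω)) := by
  have hZm : AEStronglyMeasurable Z (P'.map T) := by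
    rw [hT.map_eq]
    exact hZ.1
  refine ⟨hZm.comp_aemeasurable hT.aemeasurable, fun p h0 h1 => ?_⟩
  refine (hZ.2 p h0 h1).congr fun K => ?_
  rw [← hT.map_eq, eLpNorm_map_measure _ hT.aemeasurable]
  · rfl
  · refine AEStronglyMeasurable.sub (Measurable.aestronglyMeasurable ?_) hZm
    fun_prop

end Subgaussian

/-! ### Khintchine constants for symmetric laws and for the normal law. -/

section Khintchine

/-- The law of a sequence of independent random variables of law `μ`. -/
noncomputable def seqLaw (μ : Measure ℝ) [IsProbabilityMeasure μ] : Measure (ℕ → ℝ) :=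
  Measure.infinitePi fun _ => μ

/-- The coordinate variables on the space of sequences. -/
def seqCoord (k : ℕ) (x : ℕ → ℝ) : ℝ := x k

lemma measurable_seqCoord (k : ℕ) : Measurable (seqCoord k) :=
  measurable_pi_apply k

instance (μ : Measure ℝ) [IsProbabilityMeasure μ] : IsProbabilityMeasure (seqLaw μ) := by
  unfold seqLaw
  infer_instance

lemma isIIDWithLaw_seqCoord (μ : Measure ℝ) [IsProbabilityMeasure μ] :
    IsIIDWithLaw (seqLaw μ) seqCoord μ :=
  ⟨iIndepFun_infinitePi (P := fun _ : ℕ => μ) (X := fun _ x => x) fun _ => measurable_id,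
    fun k => (measurePreserving_eval_infinitePi (fun _ : ℕ => μ) k).hasLaw⟩

lemma seqLaw_map_sign {μ : Measure ℝ} [IsProbabilityMeasure μ] (hμ : IsSymmetricLaw μ)
    {c : ℕ → ℝ} (hc : ∀ k, c k = 1 ∨ c k = -1) :
    (seqLaw μ).map (fun x k => c k * x k) = seqLaw μ := by
  unfold seqLaw
  rw [Measure.infinitePi_map_pi (μ := fun _ : ℕ => μ) (f := fun k y => c k * y)
    fun k => by fun_prop]
  congr 1
  ext1 k
  rcases hc k with h | h
  · simp [h]
  · simp only [h, neg_one_mul]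
    exact hμ

/-- `C` is a constant for the lower bound in the `L_1` Khintchine inequality for independent
variables of law `μ`. -/
def HasKhintchineConst (μ : Measure ℝ) [IsProbabilityMeasure μ] (C : ℝ) : Prop :=
  ∀ (K : ℕ) (v : ℕ → ℝ),
    √(∑ k ∈ Finset.range K, v k ^ 2) ≤ C * ∫ x, |partialSum seqCoord v K x| ∂seqLaw μ

lemma integral_abs_partialSum_sign {μ : Measure ℝ} [IsProbabilityMeasure μ]
    (hμ : IsSymmetricLaw μ) {c : ℕ → ℝ} (hc : ∀ k, c k = 1 ∨ c k = -1) (v : ℕ → ℝ) (K : ℕ) :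
    ∫ x, |partialSum seqCoord (fun k => c k * v k) K x| ∂seqLaw μ =
      ∫ x, |partialSum seqCoord v K x| ∂seqLaw μ := by
  conv_rhs => rw [← seqLaw_map_sign hμ hc]
  rw [integral_map (Measurable.aemeasurable (measurable_pi_lambda _ fun k =>
    (measurable_pi_apply k).const_mul _))]
  · congr 1
    ext x
    simp only [partialSum, seqCoord]
    congr 1
    refine Finset.sum_congr rfl fun k _ => ?_
    ring
  · have := measurable_seqCoord
    refine Measurable.aestronglyMeasurable ?_
    unfold partialSum
    fun_prop

/-- By symmetry, random signs may be inserted without changing the mean. For fixed `x`, the cube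
inequality is applied to the coefficients `x_k v_k`. -/
lemma hasKhintchineConst_of_symmetric {μ : Measure ℝ} [IsProbabilityMeasure μ]
    (hμ : IsSymmetricLaw μ) (hint : Integrable id μ) (h0 : 0 < ∫ x, |x| ∂μ) :
    HasKhintchineConst μ (√2 / ∫ x, |x| ∂μ) := by
  intro K v
  set m := ∫ x, |x| ∂μ with hm
  set V := √(∑ k ∈ Finset.range K, v k ^ 2) with hV
  have hV0 : 0 ≤ V := Real.sqrt_nonneg _
  have hVsq : V ^ 2 = ∑ k ∈ Finset.range K, v k ^ 2 := Real.sq_sqrt (by positivity)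
  have hlaw (k : ℕ) : HasLaw (seqCoord k) μ (seqLaw μ) := (isIIDWithLaw_seqCoord μ).2 k
  have hintk (k : ℕ) : Integrable (seqCoord k) (seqLaw μ) := by
    have h := hint
    rw [← (hlaw k).map_eq] at h
    exact h.comp_aemeasurable (hlaw k).aemeasurable
  have hintS (w : ℕ → ℝ) : Integrable (fun x => |partialSum seqCoord w K x|) (seqLaw μ) :=
    (integrable_finsetSum _ fun k _ => (hintk k).mul_const _).abs
  let c (e : Fin K → Bool) (k : ℕ) : ℝ := if h : k < K then boolSign (e ⟨k, h⟩) else 1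
  have hc (e : Fin K → Bool) (k : ℕ) : c e k = 1 ∨ c e k = -1 := by
    simp only [c]
    split_ifs with h
    · cases e ⟨k, h⟩ <;> simp
    · simp
  have hsum (e : Fin K → Bool) (x : ℕ → ℝ) : partialSum seqCoord (fun k => c e k * v k) K x =
      ∑ i, boolSign (e i) * (x i * v i) := by
    rw [partialSum, Finset.sum_range]
    refine Finset.sum_congr rfl fun i _ => ?_
    simp only [c, seqCoord, i.2, dite_true]
    ring
  have hpt (x : ℕ → ℝ) : ∑ k ∈ Finset.range K, |seqCoord k x| * v k ^ 2 ≤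
      V * (√2 * ((∑ e : Fin K → Bool, |partialSum seqCoord (fun k => c e k * v k) K x|)
        / 2 ^ K)) := by
    have h1 := sqrt_sum_sq_le_cubeMean fun i : Fin K => x i * v i
    rw [cubeMean] at h1
    simp only [← hsum] at h1
    refine le_trans ?_ (mul_le_mul_of_nonneg_left h1 hV0)
    rw [← Finset.sum_range (fun k => (x k * v k) ^ 2), hV,
      ← Real.sqrt_mul (by positivity)]
    refine Real.le_sqrt_of_sq_le ?_
    -- Cauchy–Schwarz gives `∑ |x_k| v_k² ≤ V √(∑ x_k² v_k²)`. The left side is linear in the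
    -- `|x_k|` and integrates to `m V²`.
    have h2 := Finset.sum_mul_sq_le_sq_mul_sq (Finset.range K) (fun k => |v k|)
      fun k => |x k| * |v k|
    simp only [← abs_mul, sq_abs] at h2
    convert! h2 using 3 with k
    rw [seqCoord, ← mul_assoc, mul_comm (v k), mul_assoc, abs_mul, abs_mul_self, sq]
  have hI := integral_mono (μ := seqLaw μ)
    (integrable_finsetSum _ fun k _ => (hintk k).abs.mul_const _)
    ((((integrable_finsetSum _ fun e _ => hintS fun k => c e k * v k).div_const _).const_mul
      _).const_mul _) hpt
  rw [integral_finsetSum _ fun k _ => (hintk k).abs.mul_const _, integral_const_mul,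
    integral_const_mul, integral_div, integral_finsetSum _ fun e _ => hintS _] at hI
  simp only [integral_abs_partialSum_sign hμ (hc _), integral_mul_const] at hI
  have hmk (k : ℕ) : ∫ x, |seqCoord k x| ∂seqLaw μ = m :=
    (hlaw k).integral_comp (f := fun y : ℝ => |y|) (by fun_prop)
  simp only [hmk, ← Finset.mul_sum, ← hVsq] at hI
  simp only [Finset.sum_const, Finset.card_univ, Fintype.card_pi, Fintype.card_bool,
    Finset.prod_const, Fintype.card_fin, nsmul_eq_mul, Nat.cast_pow, Nat.cast_ofNat] at hI
  rw [mul_div_cancel_left₀ _ (by positivity)] at hI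
  rcases hV0.eq_or_lt with h | h
  · rw [← h]
    have : 0 ≤ ∫ x, |partialSum seqCoord v K x| ∂seqLaw μ :=
      integral_nonneg fun x => abs_nonneg _
    positivity
  · rw [div_mul_eq_mul_div, le_div_iff₀ h0]
    refine le_of_mul_le_mul_left ?_ h
    linarith

lemma integral_abs_gaussianReal_std : ∫ x, |x| ∂gaussianReal 0 1 = √(2 / Real.pi) := by
  rw [integral_gaussianReal_eq_integral_smul one_ne_zero]
  have h1 : (fun x : ℝ => gaussianPDFReal 0 1 x • |x|) =
      fun x => (√(2 * Real.pi))⁻¹ * (fun y : ℝ => y * Real.exp (-(1 / 2) * y ^ (2 : ℝ))) |x| := by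
    ext x
    simp [gaussianPDFReal]
    ring_nf
  rw [h1, integral_const_mul,
    integral_comp_abs (f := fun y : ℝ => y * Real.exp (-(1 / 2) * y ^ (2 : ℝ)))]
  have h2 := integral_rpow_mul_exp_neg_mul_rpow (p := 2) (q := 1) (b := 1 / 2) (by norm_num)
    (by norm_num) (by norm_num)
  simp only [Real.rpow_one] at h2
  rw [h2]
  norm_num
  have := Real.pi_pos
  have hs : √2 * √2 = 2 := Real.mul_self_sqrt zero_le_two
  field_simp
  linarith

lemma hasLaw_partialSum_gaussian (v : ℕ → ℝ) (K : ℕ) :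
    HasLaw (partialSum seqCoord v K)
      (gaussianReal 0 (∑ k ∈ Finset.range K, ‖v k‖₊ ^ 2)) (seqLaw (gaussianReal 0 1)) := by
  have hiid := isIIDWithLaw_seqCoord (gaussianReal 0 1)
  induction K with
  | zero =>
    simp only [Finset.range_zero, Finset.sum_empty, gaussianReal_zero_var]
    exact hasLaw_dirac_of_ae_eq (ae_of_all _ fun x => by simp [partialSum])
  | succ K ih =>
    have hK : HasLaw (fun x => seqCoord K x * v K) (gaussianReal 0 (‖v K‖₊ ^ 2))
        (seqLaw (gaussianReal 0 1)) := by
      have := gaussianReal_mul_const (hiid.2 K) (v K)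
      convert! this using 2
      · simp
      · rw [mul_one]
        refine NNReal.eq ?_
        change |v K| ^ 2 = v K ^ 2
        rw [sq_abs]
    have hind : iIndepFun (fun k x => seqCoord k x * v k) (seqLaw (gaussianReal 0 1)) :=
      hiid.1.comp (fun k x => x * v k) fun k => by fun_prop
    have h2 := hind.indepFun_finsetSum_of_notMem
      (fun k => (measurable_seqCoord k).mul_const _) (Finset.notMem_range_self (n := K))
    have e1 : (∑ j ∈ Finset.range K, fun x => seqCoord j x * v j) = partialSum seqCoord v K := by
      ext x
      simp [partialSum]
    rw [e1] at h2
    have h3 := gaussianReal_add_gaussianReal_of_indepFun h2 ih.map_eq hK.map_eq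
    refine ⟨(ih.aemeasurable.add hK.aemeasurable).congr (ae_of_all _ fun x => ?_), ?_⟩
    · simp [partialSum, Finset.sum_range_succ]
    · rw [Finset.sum_range_succ]
      rw [add_zero] at h3
      rw [← h3]
      congr 1
      ext x
      simp [partialSum, Finset.sum_range_succ]

/-- Equality holds here, since the partial sum has the law of `V` times a standard normal variable.
The bound for general symmetric laws would only give `√π`. -/
lemma hasKhintchineConst_gaussian : HasKhintchineConst (gaussianReal 0 1) √(Real.pi / 2) := by
  intro K v
  set V := √(∑ k ∈ Finset.range K, v k ^ 2) with hV
  have hV0 : 0 ≤ V := Real.sqrt_nonneg _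
  have hlaw := hasLaw_partialSum_gaussian v K
  have hscale : HasLaw (fun x : ℝ => V * x) (gaussianReal 0 (∑ k ∈ Finset.range K, ‖v k‖₊ ^ 2))
      (gaussianReal 0 1) := by
    have := gaussianReal_const_mul (HasLaw.id (μ := gaussianReal 0 1)) V
    convert! this using 2
    · simp
    · rw [mul_one]
      refine NNReal.eq ?_
      push_cast
      rw [hV, Real.sq_sqrt (by positivity)]
      simp
  have h1 : ∫ x, |partialSum seqCoord v K x| ∂seqLaw (gaussianReal 0 1) = V * √(2 / Real.pi) := by
    rw [← integral_abs_gaussianReal_std, ← integral_const_mul]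
    have e1 := hlaw.integral_comp (f := fun y : ℝ => |y|) (by fun_prop)
    have e2 := hscale.integral_comp (f := fun y : ℝ => |y|) (by fun_prop)
    refine (e1.trans e2.symm).trans ?_
    congr 1
    ext x
    simp [abs_mul, abs_of_nonneg hV0]
  rw [h1, mul_left_comm, ← Real.sqrt_mul (by positivity)]
  have : Real.pi / 2 * (2 / Real.pi) = 1 := by field_simp
  simp [this]

lemma tendsto_integral_abs_of_eLpNorm_one {Ω : Type*} [MeasurableSpace Ω] {P : Measure Ω}
    {S : ℕ → Ω → ℝ} {Z : Ω → ℝ} (hS : ∀ K, Integrable (S K) P) (hZ : Integrable Z P)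
    (h : Tendsto (fun K => eLpNorm (S K - Z) 1 P) atTop (𝓝 0)) :
    Tendsto (fun K => ∫ ω, |S K ω| ∂P) atTop (𝓝 (∫ ω, |Z ω| ∂P)) := by
  refine tendsto_integral_of_L1' _ hZ.abs.aestronglyMeasurable
    (Eventually.of_forall fun K => (hS K).abs) ?_
  refine tendsto_of_tendsto_of_tendsto_of_le_of_le tendsto_const_nhds h (fun _ => zero_le)
    fun K => eLpNorm_mono fun ω => ?_
  simpa using abs_abs_sub_abs_le_abs_sub (S K ω) (Z ω)

/-- The Khintchine inequality for the difference of two random series. -/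
lemma HasKhintchineConst.norm_sub_le {μ : Measure ℝ} [IsProbabilityMeasure μ] {C : ℝ}
    (hC : HasKhintchineConst μ C) (hμ : IsSubgaussianLaw μ) {v w : lp (fun _ : ℕ => ℝ) 2}
    {Z Z' : (ℕ → ℝ) → ℝ} (hZ : IsSeriesSum (seqLaw μ) seqCoord v Z)
    (hZ' : IsSeriesSum (seqLaw μ) seqCoord w Z') :
    ‖v - w‖ ≤ C * ∫ x, |Z x - Z' x| ∂seqLaw μ := by
  have hiid := isIIDWithLaw_seqCoord μ
  have hint (u : ℕ → ℝ) (K : ℕ) : Integrable (partialSum seqCoord u K) (seqLaw μ) :=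
    memLp_one_iff_integrable.1 (hiid.memLp_partialSum hμ u K)
  have hsub (K : ℕ) : partialSum seqCoord (v - w : lp (fun _ : ℕ => ℝ) 2) K =
      partialSum seqCoord v K - partialSum seqCoord w K := by
    ext x
    simp [partialSum, mul_sub, Finset.sum_sub_distrib]
  have hlim : Tendsto
      (fun K => eLpNorm (partialSum seqCoord (v - w : lp (fun _ : ℕ => ℝ) 2) K - (Z - Z')) 1
        (seqLaw μ)) atTop (𝓝 0) := by
    have h := hZ.tendsto_one.add hZ'.tendsto_one
    rw [add_zero] at h
    refine tendsto_of_tendsto_of_tendsto_of_le_of_le tendsto_const_nhds h (fun _ => zero_le)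
      fun K => ?_
    have e : partialSum seqCoord (v - w : lp (fun _ : ℕ => ℝ) 2) K - (Z - Z') =
        (partialSum seqCoord v K - Z) - (partialSum seqCoord w K - Z') := by
      rw [hsub]
      abel
    simp only [e]
    exact eLpNorm_sub_le ((hint _ K).1.sub hZ.1) ((hint _ K).1.sub hZ'.1) le_rfl
  have hR := (tendsto_integral_abs_of_eLpNorm_one (hint _)
    ((hZ.integrable hiid hμ).sub (hZ'.integrable hiid hμ)) hlim).const_mul C
  have hL : Tendsto (fun K => √(∑ k ∈ Finset.range K, (v - w) k ^ 2)) atTop (𝓝 ‖v - w‖) := by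
    have h := lp.hasSum_norm (p := 2) (by norm_num) (v - w)
    simp only [ENNReal.toReal_ofNat, Real.rpow_two, Real.norm_eq_abs, sq_abs] at h
    have h2 := h.tendsto_sum_nat.sqrt
    rwa [Real.sqrt_sq (norm_nonneg _)] at h2
  exact le_of_tendsto_of_tendsto' hL hR fun K => hC K _

end Khintchine

/-! ### Replacing Rademacher variables by random series over a finite index set. -/

section Comparison

variable {T : Type*} [Fintype T]

/-- The law `ρ` of a random vector is dominated by `ν` for the expected maximum of the coordinates,
after any deterministic translation. -/
def SupDominated (ρ ν : Measure (T → ℝ)) : Prop :=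
  ∀ f : T → ℝ, ∫ y, ⨆ s, (y s + f s) ∂ρ ≤ ∫ y, ⨆ s, (y s + f s) ∂ν

lemma bddAbove_range_of_fintype (y : T → ℝ) : BddAbove (Set.range y) :=
  (Set.finite_range y).bddAbove

lemma measurable_iSup_coord : Measurable fun y : T → ℝ => ⨆ s, y s :=
  Measurable.iSup fun s => measurable_pi_apply s

lemma integrable_id_map {Ω : Type*} [MeasurableSpace Ω] {P : Measure Ω} {U : Ω → T → ℝ}
    (hU : Integrable U P) : Integrable id (P.map U) :=
  (integrable_map_measure (by fun_prop) hU.aemeasurable).2 hU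

lemma map_sum_insert_eq_conv {ι Ω : Type*} [DecidableEq ι] [MeasurableSpace Ω] {P : Measure Ω}
    [IsProbabilityMeasure P] {A : ι → Ω → T → ℝ} (hA : iIndepFun A P)
    (hAi : ∀ i, Integrable (A i) P) {t : Finset ι} {i : ι} (hi : i ∉ t) :
    P.map (∑ j ∈ insert i t, A j) = (P.map (A i)) ∗ (P.map (∑ j ∈ t, A j)) := by
  rw [Finset.sum_insert hi]
  exact (hA.indepFun_finsetSum_of_notMem₀ (fun j => (hAi j).aemeasurable)
    hi).symm.map_add_eq_map_conv_map₀ (hAi i).aemeasurable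
      (integrable_finsetSum' _ fun j _ => hAi j).aemeasurable

variable [Nonempty T]

lemma abs_iSup_le_norm (y : T → ℝ) : |⨆ s, y s| ≤ ‖y‖ := by
  obtain ⟨s, hs⟩ := exists_eq_ciSup_of_finite (f := y)
  rw [← hs]
  exact norm_le_pi_norm y s

lemma integrable_iSup {Ω : Type*} [MeasurableSpace Ω] {P : Measure Ω} {A : Ω → T → ℝ}
    (hA : Integrable A P) : Integrable (fun ω => ⨆ s, A ω s) P :=
  hA.mono (measurable_iSup_coord.comp_aemeasurable hA.aemeasurable).aestronglyMeasurable
    (ae_of_all _ fun ω => abs_iSup_le_norm (A ω))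

lemma integral_iSup_conv {ρ ν : Measure (T → ℝ)} [IsProbabilityMeasure ρ] [IsProbabilityMeasure ν]
    (hρ : Integrable id ρ) (hν : Integrable id ν) (f : T → ℝ) :
    ∫ y, ⨆ s, (y s + f s) ∂(ρ ∗ ν) = ∫ x, ∫ y, ⨆ s, (y s + (x s + f s)) ∂ν ∂ρ := by
  have hid : Integrable id (ρ ∗ ν) := by
    rw [Measure.conv, integrable_map_measure (by fun_prop) (by fun_prop)]
    exact (hρ.comp_fst ν).add (hν.comp_snd ρ)
  have hint : Integrable (fun y : T → ℝ => ⨆ s, (y s + f s)) (ρ ∗ ν) :=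
    integrable_iSup (A := fun (y : T → ℝ) s => y s + f s) (hid.add (integrable_const f))
  rw [integral_conv hint]
  congr! 6 with x y s
  simp only [Pi.add_apply]
  ring

lemma integrable_prod_iSup {ρ ν : Measure (T → ℝ)} [IsProbabilityMeasure ρ]
    [IsProbabilityMeasure ν] (hρ : Integrable id ρ) (hν : Integrable id ν) (f : T → ℝ) :
    Integrable (fun p : (T → ℝ) × (T → ℝ) => ⨆ s, (p.2 s + (p.1 s + f s))) (ρ.prod ν) :=
  integrable_iSup (A := fun (p : (T → ℝ) × (T → ℝ)) s => p.2 s + (p.1 s + f s))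
    ((hν.comp_snd ρ).add ((hρ.comp_fst ν).add (integrable_const f)))

/-- Freezing one summand makes it part of the translation, so the other can be replaced. Fubini then
exchanges the roles. -/
lemma SupDominated.conv {ρ₁ ρ₂ ν₁ ν₂ : Measure (T → ℝ)} [IsProbabilityMeasure ρ₁]
    [IsProbabilityMeasure ρ₂] [IsProbabilityMeasure ν₁] [IsProbabilityMeasure ν₂]
    (hρ₁ : Integrable id ρ₁) (hρ₂ : Integrable id ρ₂) (hν₁ : Integrable id ν₁)
    (hν₂ : Integrable id ν₂) (h₁ : SupDominated ρ₁ ν₁) (h₂ : SupDominated ρ₂ ν₂) :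
    SupDominated (ρ₁ ∗ ρ₂) (ν₁ ∗ ν₂) := by
  intro f
  calc ∫ y, ⨆ s, (y s + f s) ∂(ρ₁ ∗ ρ₂)
      = ∫ x, ∫ y, ⨆ s, (y s + (x s + f s)) ∂ρ₂ ∂ρ₁ := integral_iSup_conv hρ₁ hρ₂ f
    _ ≤ ∫ x, ∫ y, ⨆ s, (y s + (x s + f s)) ∂ν₂ ∂ρ₁ :=
        integral_mono (integrable_prod_iSup hρ₁ hρ₂ f).integral_prod_left
          (integrable_prod_iSup hρ₁ hν₂ f).integral_prod_left fun x => h₂ fun s => x s + f s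
    _ = ∫ y, ∫ x, ⨆ s, (x s + (y s + f s)) ∂ρ₁ ∂ν₂ := by
        rw [integral_integral_swap (integrable_prod_iSup hρ₁ hν₂ f)]
        simp only [add_left_comm]
    _ ≤ ∫ y, ∫ x, ⨆ s, (x s + (y s + f s)) ∂ν₁ ∂ν₂ :=
        integral_mono (integrable_prod_iSup hν₂ hρ₁ f).integral_prod_left
          (integrable_prod_iSup hν₂ hν₁ f).integral_prod_left fun y => h₁ fun s => y s + f s
    _ = ∫ y, ⨆ s, (y s + f s) ∂(ν₁ ∗ ν₂) := by
        rw [integral_iSup_conv hν₁ hν₂, integral_integral_swap (integrable_prod_iSup hν₂ hν₁ f)]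
        simp only [add_left_comm]

lemma SupDominated.sum {ι Ω Ω' : Type*} [MeasurableSpace Ω] [MeasurableSpace Ω'] {P : Measure Ω}
    {P' : Measure Ω'} [IsProbabilityMeasure P] [IsProbabilityMeasure P'] {A : ι → Ω → T → ℝ}
    {B : ι → Ω' → T → ℝ} (hA : iIndepFun A P) (hB : iIndepFun B P')
    (hAi : ∀ i, Integrable (A i) P) (hBi : ∀ i, Integrable (B i) P')
    (h : ∀ i, SupDominated (P.map (A i)) (P'.map (B i))) (t : Finset ι) :
    SupDominated (P.map (∑ i ∈ t, A i)) (P'.map (∑ i ∈ t, B i)) := by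
  classical
  induction t using Finset.induction_on with
  | empty =>
    intro f
    simp only [Finset.sum_empty]
    change ∫ y, ⨆ s, (y s + f s) ∂(P.map fun _ => (0 : T → ℝ)) ≤
      ∫ y, ⨆ s, (y s + f s) ∂(P'.map fun _ => (0 : T → ℝ))
    rw [Measure.map_const, Measure.map_const]
    simp
  | insert i t hi ih =>
    have hSA := integrable_finsetSum' t fun j _ => hAi j
    have hSB := integrable_finsetSum' t fun j _ => hBi j
    have := Measure.isProbabilityMeasure_map (hAi i).aemeasurable
    have := Measure.isProbabilityMeasure_map (hBi i).aemeasurable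
    have := Measure.isProbabilityMeasure_map hSA.aemeasurable
    have := Measure.isProbabilityMeasure_map hSB.aemeasurable
    rw [map_sum_insert_eq_conv hA hAi hi, map_sum_insert_eq_conv hB hBi hi]
    exact (h i).conv (integrable_id_map (hAi i)) (integrable_id_map hSA)
      (integrable_id_map (hBi i)) (integrable_id_map hSB) ih

lemma integral_rademacherLaw (g : ℝ → ℝ) :
    ∫ t, g t ∂rademacherLaw = (g (-1) + g 1) / 2 := by
  have h (a : ℝ) : Integrable g ((2⁻¹ : ℝ≥0∞) • Measure.dirac a) :=
    (integrable_dirac (by simp [enorm])).smul_measure (by simp)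
  rw [rademacherLaw, integral_add_measure (h _) (h _), integral_smul_measure,
    integral_smul_measure, integral_dirac, integral_dirac]
  simp
  ring

instance : IsProbabilityMeasure rademacherLaw := by
  constructor
  simp [rademacherLaw, ENNReal.inv_two_add_inv_two]

lemma IsIIDWithLaw.integrable_rademacher {ι Ω : Type*} [MeasurableSpace Ω] {P : Measure Ω}
    {X : ι → Ω → ℝ} (hX : IsIIDWithLaw P X rademacherLaw) (i : ι) : Integrable (X i) P := by
  have h1 : Integrable id rademacherLaw :=
    (integrable_dirac (by simp [enorm])).smul_measure (by simp) |>.add_measure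
      ((integrable_dirac (by simp [enorm])).smul_measure (by simp))
  rw [← (hX.2 i).map_eq] at h1
  exact h1.comp_aemeasurable (hX.2 i).aemeasurable

lemma IsIIDWithLaw.neg {ι Ω : Type*} [MeasurableSpace Ω] {P : Measure Ω} {X : ι → Ω → ℝ}
    {μ : Measure ℝ} (hμ : IsSymmetricLaw μ) (hX : IsIIDWithLaw P X μ) :
    IsIIDWithLaw P (fun k ω => -X k ω) μ := by
  refine ⟨hX.1.comp (fun _ x => -x) fun _ => measurable_neg, fun k => ?_⟩
  have h : HasLaw (fun x : ℝ => -x) μ μ := ⟨measurable_neg.aemeasurable, hμ⟩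
  exact h.comp (hX.2 k)

lemma seqLaw_map_neg {μ : Measure ℝ} [IsProbabilityMeasure μ] (hμ : IsSymmetricLaw μ) :
    HasLaw (fun x : ℕ → ℝ => fun k => -x k) (seqLaw μ) (seqLaw μ) := by
  refine ⟨(measurable_pi_lambda _ fun k => (measurable_pi_apply k).neg).aemeasurable, ?_⟩
  have := seqLaw_map_sign hμ (c := fun _ => -1) fun _ => Or.inr rfl
  simpa only [neg_one_mul] using this

lemma IsSeriesSum.ae_neg {μ : Measure ℝ} [IsProbabilityMeasure μ] (hμ : IsSymmetricLaw μ)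
    {v : lp (fun _ : ℕ => ℝ) 2} {Z : (ℕ → ℝ) → ℝ} (hZ : IsSeriesSum (seqLaw μ) seqCoord v Z) :
    (fun x : ℕ → ℝ => Z fun k => -x k) =ᵐ[seqLaw μ] fun x => -Z x := by
  have h1 := hZ.comp measurable_seqCoord (seqLaw_map_neg hμ)
  exact IsSeriesSum.ae_eq (X := fun k x => -seqCoord k x) ((isIIDWithLaw_seqCoord μ).neg hμ) h1
    hZ.neg

/-- One step of the vector contraction inequality: a single Rademacher variable is replaced by
a random series. -/
lemma supDominated_rademacher {μ : Measure ℝ} [IsProbabilityMeasure μ] (hsym : IsSymmetricLaw μ)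
    (hsub : IsSubgaussianLaw μ) {C : ℝ} (hC : HasKhintchineConst μ C) (ψ : T → ℝ)
    (φ : T → lp (fun _ : ℕ => ℝ) 2) (h : ∀ s s', ψ s - ψ s' ≤ ‖φ s - φ s'‖)
    {G : T → (ℕ → ℝ) → ℝ} (hGm : ∀ s, Measurable (G s))
    (hG : ∀ s, IsSeriesSum (seqLaw μ) seqCoord (φ s) (G s)) :
    SupDominated (rademacherLaw.map fun t s => t * ψ s)
      ((seqLaw μ).map fun x s => C * G s x) := by
  intro f
  have hiid := isIIDWithLaw_seqCoord μ
  have hGi (s : T) : Integrable (G s) (seqLaw μ) := (hG s).integrable hiid hsub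
  have hmf : Measurable fun y : T → ℝ => ⨆ s, (y s + f s) :=
    Measurable.iSup fun s => (measurable_pi_apply s).add_const _
  rw [integral_map (by fun_prop) hmf.aestronglyMeasurable,
    integral_map (by fun_prop) hmf.aestronglyMeasurable,
    integral_rademacherLaw fun t => ⨆ s, (t * ψ s + f s)]
  have hint (c : ℝ) : Integrable (fun x => ⨆ s, (c * G s x + f s)) (seqLaw μ) :=
    integrable_iSup (A := fun x s => c * G s x + f s)
      (Integrable.of_eval fun s => ((hGi s).const_mul c).add (integrable_const _))
  have hneg : ∫ x, ⨆ s, (-C * G s x + f s) ∂seqLaw μ = ∫ x, ⨆ s, (C * G s x + f s) ∂seqLaw μ := by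
    rw [← (seqLaw_map_neg hsym).integral_comp (f := fun x => ⨆ s, (C * G s x + f s))
      (Measurable.iSup fun s => by have := hGm s; fun_prop).aestronglyMeasurable]
    refine integral_congr_ae ?_
    filter_upwards [ae_all_iff.2 fun s => (hG s).ae_neg hsym] with x hx
    simp [hx]
  obtain ⟨s₁, h₁⟩ := exists_eq_ciSup_of_finite (f := fun s => 1 * ψ s + f s)
  obtain ⟨s₂, h₂⟩ := exists_eq_ciSup_of_finite (f := fun s => -1 * ψ s + f s)
  rw [← h₁, ← h₂]
  have hK := hC.norm_sub_le hsub (hG s₁) (hG s₂)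
  -- The sign of `G s₁ x - G s₂ x` decides which of `s₁`, `s₂` is tested in which supremum.
  have hpt (x : ℕ → ℝ) : C * |G s₁ x - G s₂ x| + (f s₁ + f s₂) ≤
      (⨆ s, (C * G s x + f s)) + ⨆ s, (-C * G s x + f s) := by
    have hb (c : ℝ) (s : T) : c * G s x + f s ≤ ⨆ s, (c * G s x + f s) :=
      le_ciSup (bddAbove_range_of_fintype fun s => c * G s x + f s) s
    rcases abs_cases (G s₁ x - G s₂ x) with h | h <;> rw [h.1]
    · linarith [hb C s₁, hb (-C) s₂]
    · linarith [hb C s₂, hb (-C) s₁]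
  have hD : Integrable (fun x => C * |G s₁ x - G s₂ x|) (seqLaw μ) :=
    ((hGi s₁).sub (hGi s₂)).abs.const_mul C
  have hI := integral_mono (hD.add (integrable_const (f s₁ + f s₂)))
    ((hint C).add (hint (-C))) hpt
  simp only [Pi.add_apply] at hI
  rw [integral_add hD (integrable_const _),
    integral_add (hint C) (hint (-C)), hneg, integral_const_mul] at hI
  simp at hI
  linarith [h s₁ s₂]

/-- Currying carries the product measure over `ι × ℕ` to the product over `ι` of sequence laws. -/
lemma iIndepFun_rows {ι Ω : Type*} [Countable ι] [MeasurableSpace Ω] {P : Measure Ω}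
    [IsProbabilityMeasure P] {μ : Measure ℝ} [IsProbabilityMeasure μ] {X : ι × ℕ → Ω → ℝ}
    (hX : IsIIDWithLaw P X μ) :
    iIndepFun (fun i ω k => X (i, k) ω) P ∧
      ∀ i, HasLaw (fun ω k => X (i, k) ω) (seqLaw μ) P := by
  have hlaw : HasLaw (fun ω p => X p ω) (Measure.infinitePi fun _ => μ) P :=
    hX.1.hasLaw_infinitePi hX.2 (aemeasurable_pi_lambda _ fun p => (hX.2 p).aemeasurable)
  have hrow (i : ι) : HasLaw (fun ω k => X (i, k) ω) (seqLaw μ) P :=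
    (hX.1.precomp (Prod.mk_right_injective i)).hasLaw_infinitePi (fun k => hX.2 (i, k))
      (aemeasurable_pi_lambda _ fun k => (hX.2 (i, k)).aemeasurable)
  refine ⟨?_, hrow⟩
  rw [iIndepFun_iff_hasLaw_Pi_infinitePi hrow
    (aemeasurable_pi_lambda _ fun i => (hrow i).aemeasurable)]
  have hcurry : HasLaw (MeasurableEquiv.curry ι ℕ ℝ)
      (Measure.infinitePi fun _ : ι => Measure.infinitePi fun _ : ℕ => μ)
      (Measure.infinitePi fun _ : ι × ℕ => μ) :=
    ⟨(MeasurableEquiv.curry ι ℕ ℝ).measurable.aemeasurable,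
      Measure.infinitePi_map_curry fun _ _ => μ⟩
  exact hcurry.comp hlaw

/-- The vector contraction inequality for finite index sets. -/
lemma integral_iSup_rademacher_le {μ : Measure ℝ} [IsProbabilityMeasure μ]
    (hsym : IsSymmetricLaw μ) (hsub : IsSubgaussianLaw μ) {C : ℝ} (hC0 : 0 ≤ C)
    (hC : HasKhintchineConst μ C) {n : ℕ} (ψ : Fin n → T → ℝ)
    (φ : Fin n → T → lp (fun _ : ℕ => ℝ) 2) (h : ∀ i s s', ψ i s - ψ i s' ≤ ‖φ i s - φ i s'‖)
    {Ω Ω' : Type*} [MeasurableSpace Ω] [MeasurableSpace Ω'] {P : Measure Ω} {P' : Measure Ω'}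
    [IsProbabilityMeasure P] [IsProbabilityMeasure P'] {ε : Fin n → Ω → ℝ}
    (hε : IsIIDWithLaw P ε rademacherLaw) {X : Fin n × ℕ → Ω' → ℝ} (hX : IsIIDWithLaw P' X μ) :
    ∫ ω, ⨆ s, ∑ i, ε i ω * ψ i s ∂P ≤
      C * ∫ ω, ⨆ s, ∑ i, randomSeries P' (fun k => X (i, k)) (φ i s) ω ∂P' := by
  have hcan (v : lp (fun _ : ℕ => ℝ) 2) :=
    isSeriesSum_randomSeries (isIIDWithLaw_seqCoord μ) hsub v
  -- `randomSeries` is an arbitrary version of the sum. A measurable version on sequence space,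
  -- evaluated at each row, agrees with it almost surely and makes the rows' contributions
  -- independent.
  let G (v : lp (fun _ : ℕ => ℝ) 2) : (ℕ → ℝ) → ℝ := (hcan v).1.mk
  have hGm (v) : Measurable (G v) := (hcan v).1.stronglyMeasurable_mk.measurable
  have hG (v) : IsSeriesSum (seqLaw μ) seqCoord v (G v) := (hcan v).congr (hcan v).1.ae_eq_mk
  obtain ⟨hind, hrow⟩ := iIndepFun_rows hX
  have hXi (i : Fin n) : IsIIDWithLaw P' (fun k => X (i, k)) μ :=
    ⟨hX.1.precomp (Prod.mk_right_injective i), fun k => hX.2 (i, k)⟩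
  have hae (i : Fin n) (s : T) : (fun ω => G (φ i s) fun k => X (i, k) ω) =ᵐ[P']
      randomSeries P' (fun k => X (i, k)) (φ i s) := by
    have h1 := (hG (φ i s)).comp measurable_seqCoord (hrow i)
    exact IsSeriesSum.ae_eq (X := fun k => X (i, k)) (hXi i) h1
      (isSeriesSum_randomSeries (hXi i) hsub _)
  let A (i : Fin n) (ω : Ω) (s : T) : ℝ := ε i ω * ψ i s
  let B (i : Fin n) (ω : Ω') (s : T) : ℝ := C * G (φ i s) fun k => X (i, k) ω
  have hA : iIndepFun A P := hε.1.comp (fun i t s => t * ψ i s) fun i => by fun_prop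
  have hB : iIndepFun B P' := hind.comp (fun i x s => C * G (φ i s) x) fun i =>
    measurable_pi_lambda _ fun s => (hGm _).const_mul C
  have hAi (i : Fin n) : Integrable (A i) P := Integrable.of_eval fun s =>
    (hε.integrable_rademacher i).mul_const _
  have hBi (i : Fin n) : Integrable (B i) P' := Integrable.of_eval fun s =>
    (((isSeriesSum_randomSeries (hXi i) hsub (φ i s)).integrable (hXi i) hsub).congr
      (hae i s).symm).const_mul C
  have hdom (i : Fin n) : SupDominated (P.map (A i)) (P'.map (B i)) := by
    have e1 : P.map (A i) = rademacherLaw.map fun t s => t * ψ i s := by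
      rw [← (hε.2 i).map_eq, AEMeasurable.map_map_of_aemeasurable (by fun_prop)
        (hε.2 i).aemeasurable]
      rfl
    have hm : Measurable fun (x : ℕ → ℝ) (s : T) => C * G (φ i s) x :=
      measurable_pi_lambda _ fun s => (hGm _).const_mul C
    have e2 : P'.map (B i) = (seqLaw μ).map fun x s => C * G (φ i s) x := by
      rw [← (hrow i).map_eq, AEMeasurable.map_map_of_aemeasurable hm.aemeasurable
        (hrow i).aemeasurable]
      rfl
    rw [e1, e2]
    exact supDominated_rademacher hsym hsub hC (ψ i) (φ i) (h i) (fun s => hGm _)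
      fun s => hG _
  have hfin := SupDominated.sum hA hB hAi hBi hdom Finset.univ 0
  simp only [Pi.zero_apply, add_zero] at hfin
  rw [integral_map (integrable_finsetSum' _ fun j _ => hAi j).aemeasurable
      measurable_iSup_coord.aestronglyMeasurable,
    integral_map (integrable_finsetSum' _ fun j _ => hBi j).aemeasurable
      measurable_iSup_coord.aestronglyMeasurable] at hfin
  simp only [Finset.sum_apply] at hfin
  refine hfin.trans_eq ?_
  rw [← integral_const_mul]
  refine integral_congr_ae ?_
  filter_upwards [ae_all_iff.2 fun i => ae_all_iff.2 fun s => hae i s] with ω hω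
  simp only [B, ← Finset.mul_sum, hω]
  rw [Real.mul_iSup_of_nonneg hC0]

end Comparison

/-! ### Expectations in the extended reals and passage to countable suprema. -/

section ExtendedExpectation

variable {Ω : Type*} [MeasurableSpace Ω] {P : Measure Ω}

lemma extExpectation_mono {f g : Ω → EReal} (h : ∀ ω, f ω ≤ g ω) :
    extExpectation P f ≤ extExpectation P g := by
  refine EReal.sub_le_sub ?_ ?_
  · exact EReal.coe_ennreal_le_coe_ennreal_iff.2
      (lintegral_mono fun ω => EReal.toENNReal_le_toENNReal (h ω))
  · exact EReal.coe_ennreal_le_coe_ennreal_iff.2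
      (lintegral_mono fun ω => EReal.toENNReal_le_toENNReal (EReal.neg_le_neg_iff.2 (h ω)))

lemma extExpectation_coe {f : Ω → ℝ} (hf : Integrable f P) :
    extExpectation P (fun ω => (f ω : EReal)) = ((∫ ω, f ω ∂P : ℝ) : EReal) := by
  have hp : ∫⁻ ω, ENNReal.ofReal (f ω) ∂P ≠ ∞ := hf.lintegral_lt_top.ne
  have hn : ∫⁻ ω, ENNReal.ofReal (-f ω) ∂P ≠ ∞ := hf.neg.lintegral_lt_top.ne
  rw [integral_eq_lintegral_pos_part_sub_lintegral_neg_part hf, EReal.coe_sub,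
    EReal.coe_ennreal_toReal hp, EReal.coe_ennreal_toReal hn]
  simp only [extExpectation, ← EReal.coe_neg, EReal.toENNReal_of_ne_top (EReal.coe_ne_top _),
    EReal.toReal_coe]

lemma coe_iSup_of_finite {T : Type*} [Finite T] [Nonempty T] (y : T → ℝ) :
    ⨆ s, (y s : EReal) = ((⨆ s, y s : ℝ) : EReal) := by
  refine le_antisymm (iSup_le fun s => EReal.coe_le_coe_iff.2
    (le_ciSup (Set.finite_range y).bddAbove s)) ?_
  obtain ⟨s, hs⟩ := exists_eq_ciSup_of_finite (f := y)
  rw [← hs]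
  exact le_iSup (fun s => (y s : EReal)) s

/-- The expected supremum of a countable family of integrable variables is bounded by any bound for
the expected suprema of its finite subfamilies. -/
lemma extExpectation_iSup_le {S : Type*} [Countable S] [Nonempty S] {g : S → Ω → ℝ}
    (hg : ∀ s, Integrable (g s) P) {B : EReal}
    (h : ∀ T : Finset S, T.Nonempty →
      extExpectation P (fun ω => ⨆ s : T, (g s ω : EReal)) ≤ B) :
    extExpectation P (fun ω => ⨆ s, (g s ω : EReal)) ≤ B := by
  classical
  obtain ⟨e, he⟩ := exists_surjective_nat S
  let T (m : ℕ) : Finset S := (Finset.range (m + 1)).image e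
  let f (m : ℕ) (ω : Ω) : EReal := ⨆ s : T m, (g s ω : EReal)
  have hmem (m : ℕ) : e m ∈ T m := Finset.mem_image_of_mem e (by simp)
  have hmono (ω : Ω) : Monotone fun m => f m ω := by
    intro m m' hm
    refine iSup_le fun s => ?_
    have hs : (s : S) ∈ T m' := by
      refine Finset.image_subset_image ?_ s.2
      exact Finset.range_subset_range.2 (by omega)
    exact le_iSup (fun s : T m' => (g s ω : EReal)) ⟨s, hs⟩
  have hsup (ω : Ω) : ⨆ m, f m ω = ⨆ s, (g s ω : EReal) := by
    refine le_antisymm (iSup_le fun m => iSup_le fun s =>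
      le_iSup (fun s => (g s ω : EReal)) (s : S)) (iSup_le fun s => ?_)
    obtain ⟨m, rfl⟩ := he s
    exact (le_iSup (fun s : T m => (g s ω : EReal)) ⟨e m, hmem m⟩).trans (le_iSup (f · ω) m)
  have hlim (ω : Ω) : Tendsto (fun m => f m ω) atTop (𝓝 (⨆ s, (g s ω : EReal))) := by
    rw [← hsup]
    exact tendsto_atTop_iSup (hmono ω)
  have hfm (m : ℕ) : AEMeasurable (f m) P :=
    AEMeasurable.iSup fun s => (hg s).aemeasurable.coe_real_ereal
  have hpos : Tendsto (fun m => ∫⁻ ω, (f m ω).toENNReal ∂P) atTop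
      (𝓝 (∫⁻ ω, (⨆ s, (g s ω : EReal)).toENNReal ∂P)) := by
    refine lintegral_tendsto_of_tendsto_of_monotone (fun m => (hfm m).ereal_toENNReal)
      (ae_of_all _ fun ω m m' hm => EReal.toENNReal_le_toENNReal (hmono ω hm))
      (ae_of_all _ fun ω => ?_)
    exact (EReal.continuous_toENNReal.tendsto _).comp (hlim ω)
  -- Monotone convergence for the decreasing negative parts needs a finite first integral; the
  -- integrable `g (e 0)` provides it.
  have hfin : ∫⁻ ω, (-f 0 ω).toENNReal ∂P ≠ ∞ := by
    have h1 : ∫⁻ ω, ENNReal.ofReal (-g (e 0) ω) ∂P ≠ ∞ := (hg (e 0)).neg.lintegral_lt_top.ne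
    refine ne_top_of_le_ne_top h1 (lintegral_mono fun ω => ?_)
    have h2 : (-f 0 ω).toENNReal ≤ (-(g (e 0) ω : EReal)).toENNReal :=
      EReal.toENNReal_le_toENNReal (EReal.neg_le_neg_iff.2
        (le_iSup (fun s : T 0 => (g s ω : EReal)) ⟨e 0, hmem 0⟩))
    simpa [← EReal.coe_neg, EReal.toENNReal_of_ne_top (EReal.coe_ne_top _)] using h2
  have hanti (ω : Ω) : Antitone fun m => (-f m ω).toENNReal := fun m m' hm =>
    EReal.toENNReal_le_toENNReal (EReal.neg_le_neg_iff.2 (hmono ω hm))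
  have hneg : Tendsto (fun m => ∫⁻ ω, (-f m ω).toENNReal ∂P) atTop
      (𝓝 (∫⁻ ω, (-⨆ s, (g s ω : EReal)).toENNReal ∂P)) := by
    refine lintegral_tendsto_of_tendsto_of_antitone (fun m => (hfm m).neg.ereal_toENNReal)
      (ae_of_all _ hanti) hfin (ae_of_all _ fun ω => ?_)
    exact (EReal.continuous_toENNReal.tendsto _).comp
      ((continuous_neg.tendsto _).comp (hlim ω))
  have hneg_top : ∫⁻ ω, (-⨆ s, (g s ω : EReal)).toENNReal ∂P ≠ ∞ :=
    ne_top_of_le_ne_top hfin (le_of_tendsto hneg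
      (Eventually.of_forall fun m => lintegral_mono fun ω => hanti ω m.zero_le))
  -- The negative part has finite integral, so `∞ - ∞` cannot occur and the difference is continuous
  -- at the limit.
  have hcont := EReal.continuousAt_add
    (p := (((∫⁻ ω, (⨆ s, (g s ω : EReal)).toENNReal ∂P : ℝ≥0∞) : EReal),
      -((∫⁻ ω, (-⨆ s, (g s ω : EReal)).toENNReal ∂P : ℝ≥0∞) : EReal)))
    (Or.inr (by simpa using hneg_top)) (Or.inl (EReal.coe_ennreal_ne_bot _))
  have hprod := ((continuous_coe_ennreal_ereal.tendsto _).comp hpos).prodMk_nhds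
    ((continuous_neg.tendsto _).comp ((continuous_coe_ennreal_ereal.tendsto _).comp hneg))
  refine le_of_tendsto (hcont.tendsto.comp hprod) (Eventually.of_forall fun m => ?_)
  exact h (T m) ⟨e m, hmem m⟩

end ExtendedExpectation

/-! ### From a Khintchine constant to the contraction inequality. -/

lemma vectorContraction_of_hasKhintchineConst {μ : Measure ℝ} [IsProbabilityMeasure μ]
    (hsym : IsSymmetricLaw μ) (hsub : IsSubgaussianLaw μ) {C : ℝ} (hC0 : 0 < C)
    (hC : HasKhintchineConst μ C) : VectorContraction.{u, v, w} μ C := by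
  intro n S _ ψ φ h Ω _ P _ ε hε Ω' _ P' _ X hX
  rcases isEmpty_or_nonempty S with hS | hS
  -- The empty supremum is `⊥`, whose extended expectation under a probability measure is `⊥`.
  · simp [extExpectation]
  have hXi (i : Fin n) : IsIIDWithLaw P' (fun k => X (i, k)) μ :=
    ⟨hX.1.precomp (Prod.mk_right_injective i), fun k => hX.2 (i, k)⟩
  have hR (s : S) : Integrable
      (fun ω => ∑ i, randomSeries P' (fun k => X (i, k)) (φ i s) ω) P' :=
    integrable_finsetSum _ fun i _ =>
      (isSeriesSum_randomSeries (hXi i) hsub (φ i s)).integrable (hXi i) hsub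
  have hL (s : S) : Integrable (fun ω => ∑ i, ε i ω * ψ i s) P :=
    integrable_finsetSum _ fun i _ => (hε.integrable_rademacher i).mul_const _
  refine extExpectation_iSup_le hL fun T hT => ?_
  have := hT.to_subtype
  have hLT : Integrable (fun ω => ⨆ s : T, ∑ i, ε i ω * ψ i s) P :=
    integrable_iSup (A := fun ω (s : T) => ∑ i, ε i ω * ψ i s) (Integrable.of_eval fun s => hL s)
  have hRT : Integrable
      (fun ω => ⨆ s : T, ∑ i, randomSeries P' (fun k => X (i, k)) (φ i s) ω) P' :=
    integrable_iSup (A := fun ω (s : T) => ∑ i, randomSeries P' (fun k => X (i, k)) (φ i s) ω)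
      (Integrable.of_eval fun s => hR s)
  calc extExpectation P (fun ω => ⨆ s : T, ((∑ i, ε i ω * ψ i s : ℝ) : EReal))
      = ((∫ ω, ⨆ s : T, ∑ i, ε i ω * ψ i s ∂P : ℝ) : EReal) := by
        simp only [coe_iSup_of_finite]
        exact extExpectation_coe hLT
    _ ≤ ((C * ∫ ω, ⨆ s : T, ∑ i, randomSeries P' (fun k => X (i, k)) (φ i s) ω ∂P' : ℝ) :
          EReal) :=
        EReal.coe_le_coe_iff.2 (integral_iSup_rademacher_le hsym hsub hC0.le hC
          (fun i (s : T) => ψ i s) (fun i s => φ i s) (fun i s s' => h i s s') hε hX)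
    _ = C * extExpectation P' (fun ω => ⨆ s : T,
          ((∑ i, randomSeries P' (fun k => X (i, k)) (φ i s) ω : ℝ) : EReal)) := by
        simp only [coe_iSup_of_finite]
        rw [extExpectation_coe hRT, EReal.coe_mul]
    _ ≤ _ := by
        refine mul_le_mul_of_nonneg_left (extExpectation_mono fun ω => ?_)
          (EReal.coe_nonneg.2 hC0.le)
        exact iSup_le fun s => le_iSup
          (fun s : S => ((∑ i, randomSeries P' (fun k => X (i, k)) (φ i s) ω : ℝ) : EReal)) s

/-! ### Properties of the laws involved, and the theorem. -/

section Laws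

lemma IsSubgaussianLaw.integrable_id {μ : Measure ℝ} (h : IsSubgaussianLaw μ) :
    Integrable id μ := by
  obtain ⟨b, hb⟩ := h
  exact hb.integrable

lemma integral_abs_pos_of_ne_dirac {μ : Measure ℝ} [IsProbabilityMeasure μ]
    (hμ : μ ≠ Measure.dirac 0) (hint : Integrable id μ) : 0 < ∫ x, |x| ∂μ := by
  refine (integral_nonneg fun x => abs_nonneg x).lt_of_ne fun h => hμ ?_
  have h0 := (integral_eq_zero_iff_of_nonneg (fun x => abs_nonneg x) hint.abs).1 h.symm
  have h1 : (id : ℝ → ℝ) =ᵐ[μ] fun _ => 0 := by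
    filter_upwards [h0] with x hx
    simpa using hx
  simpa using (hasLaw_dirac_of_ae_eq h1).map_eq

lemma isSymmetricLaw_rademacherLaw : IsSymmetricLaw rademacherLaw := by
  have hm : Measurable fun x : ℝ => -x := by fun_prop
  rw [IsSymmetricLaw, rademacherLaw, Measure.map_add _ _ hm, Measure.map_smul, Measure.map_smul,
    Measure.map_dirac' hm, Measure.map_dirac' hm, neg_neg, add_comm]

lemma isSubgaussianLaw_rademacherLaw : IsSubgaussianLaw rademacherLaw := by
  -- Hoeffding's lemma; unification fills in half the length of `[-1, 1]` as the sub-gaussian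
  -- parameter.
  refine ⟨_, hasSubgaussianMGF_of_mem_Icc_of_integral_eq_zero (a := -1) (b := 1)
    aemeasurable_id ?_ ?_⟩
  · rw [rademacherLaw, ae_add_measure_iff]
    constructor <;> refine Measure.ae_smul_measure ?_ _ <;> simp [ae_dirac_eq]
  · simp [integral_rademacherLaw]

lemma isSymmetricLaw_gaussianReal : IsSymmetricLaw (gaussianReal 0 1) := by
  rw [IsSymmetricLaw, gaussianReal_map_neg, neg_zero]

lemma isSubgaussianLaw_gaussianReal : IsSubgaussianLaw (gaussianReal 0 1) :=
  ⟨1, fun t => integrable_exp_mul_gaussianReal t, fun t => by simp [mgf_id_gaussianReal]⟩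

end Laws

theorem theorem2 :
    (∀ (μ : Measure ℝ) [IsProbabilityMeasure μ],
      μ ≠ Measure.dirac 0 → IsSymmetricLaw μ → IsSubgaussianLaw μ →
        (∀ (Ω : Type w) [MeasurableSpace Ω] (P : Measure Ω) [IsProbabilityMeasure P]
          (X : ℕ → Ω → ℝ), IsIIDWithLaw P X μ →
            ∀ a : lp (fun _ : ℕ => ℝ) 2, IsSeriesSum P X a (randomSeries P X a)) ∧
        ∃ C : ℝ, 0 < C ∧ VectorContraction.{u, v, w} μ C) ∧
    VectorContraction.{u, v, w} rademacherLaw (Real.sqrt 2) ∧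
    VectorContraction.{u, v, w} (gaussianReal 0 1) (Real.sqrt (Real.pi / 2)) := by
  refine ⟨fun μ _ hμ hsym hsub => ⟨fun Ω _ P _ X hX a => isSeriesSum_randomSeries hX hsub a, ?_⟩,
    ?_, ?_⟩
  · have hpos := integral_abs_pos_of_ne_dirac hμ hsub.integrable_id
    have hC : 0 < √2 / ∫ x, |x| ∂μ := by positivity
    exact ⟨_, hC, vectorContraction_of_hasKhintchineConst hsym hsub hC
      (hasKhintchineConst_of_symmetric hsym hsub.integrable_id hpos)⟩
  · have h1 : ∫ x, |x| ∂rademacherLaw = 1 := by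
      rw [integral_rademacherLaw]
      norm_num
    have hK := hasKhintchineConst_of_symmetric isSymmetricLaw_rademacherLaw
      isSubgaussianLaw_rademacherLaw.integrable_id (by rw [h1]; exact one_pos)
    rw [h1, div_one] at hK
    exact vectorContraction_of_hasKhintchineConst isSymmetricLaw_rademacherLaw
      isSubgaussianLaw_rademacherLaw (by positivity) hK
  · exact vectorContraction_of_hasKhintchineConst isSymmetricLaw_gaussianReal
      isSubgaussianLaw_gaussianReal (Real.sqrt_pos.2 (by positivity)) hasKhintchineConst_gaussian
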